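/- Fix real numbers $\varepsilon>0$ and $\gamma>0$. There is a constant $c>0$, depending only on $\varepsilon$ and $\gamma$, such that the following holds for all integers $n\ge 0$ and $1\le s\le d$. Let $X=(X_1,\dots,X_n)$ be i.i.d. samples from an unknown distribution $\mathbf p$ on $\mathbb R^d$. An adversary, who may inspect $X$ and may use randomness of its own, modifies at most $\varepsilon n$ of the $X_i$ arbitrarily, and a (possibly randomized) algorithm observes only the resulting sample $\tilde X=(\tilde X_1,\dots,\tilde X_n)$. Suppose that there is an algorithm that, for every such adversary, outputs "null" with probability greater than $2/3$ if $\mathbf p=\mathcal N(0,I_d)$, and outputs "alternative" with probability greater than $2/3$ if $\mathbf p=\mathcal N(\theta,I_d)$ for any $\theta\in\mathbb R^d$ with $\|\theta\|_2\ge\gamma$ and $\|\theta\|_0\le s$, where $\|\theta\|_0$ is the number of nonzero coordinates of $\theta$. Then $$ n\;\ge\; c\, s\log\frac{ed}{s}, $$ that is, $n=\Omega\!\left(s\log\frac{ed}{s}\right)$ for fixed $\varepsilon,\gamma$. -/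

import Mathlib

open MeasureTheory ProbabilityTheory

namespace RobustTesting

/-- The law of `n` independent samples from the Gaussian `N(θ, I_d)` on `ℝ^d`. -/
noncomputable def gaussianSamples (n d : ℕ) (θ : EuclideanSpace ℝ (Fin d)) :
    Measure (Fin n → EuclideanSpace ℝ (Fin d)) :=
  Measure.pi fun _ => multivariateGaussian θ 1

/-- `Q` is the law of an `ε`-corrupted version of a sample of size `n` with law `P`:
for some joint law of the original sample `X ∼ P` and the observed sample `Y ∼ Q`, almost surely
at most `ε n` of the `n` observations have been modified. The adversary may use the whole of `X`
and randomness of its own to choose which observations to modify and what to put in their place. -/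
def IsCorruption {α : Type*} [MeasurableSpace α] {n : ℕ} (ε : ℝ)
    (P Q : Measure (Fin n → α)) : Prop :=
  ∃ π : Measure ((Fin n → α) × (Fin n → α)), π.fst = P ∧ π.snd = Q ∧
    ∀ᵐ p ∂π, ({i | p.1 i ≠ p.2 i}.ncard : ℝ) ≤ ε * n

/-- The number `‖θ‖₀` of nonzero coordinates of `θ`. -/
noncomputable def numNonzero {d : ℕ} (θ : EuclideanSpace ℝ (Fin d)) : ℕ :=
  {i | θ i ≠ 0}.ncard

/-- The possibly randomized algorithm `T`, which outputs `true` for the alternative and `false`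
for the null hypothesis, distinguishes `N(0, I_d)` from the family of all `N(θ, I_d)` with
`‖θ‖₂ ≥ γ` and `‖θ‖₀ ≤ s` from `n` samples under `ε`-corruption: whatever the adversary does, the
output is correct with probability greater than `2/3`. -/
def Distinguishes (ε γ : ℝ) {n d : ℕ} (s : ℕ)
    (T : Kernel (Fin n → EuclideanSpace ℝ (Fin d)) Bool) : Prop :=
  (∀ Q, IsCorruption ε (gaussianSamples n d 0) Q → 2 / 3 < (Q.bind T) {false}) ∧
    ∀ θ : EuclideanSpace ℝ (Fin d), γ ≤ ‖θ‖ → numNonzero θ ≤ s →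
      ∀ Q, IsCorruption ε (gaussianSamples n d θ) Q → 2 / 3 < (Q.bind T) {true}

end RobustTesting

namespace RobustTesting

/-! The adversary hides the signal by centring. Take the alternative `γ • v` for a random sparse
unit vector `v`, and replace each observation, independently with a small probability `δ`, by one
whose mean is a negative multiple of `v`, chosen so that the mean `a • v` of an observation averages
to zero. A Markov argument (`Distinguishes.le_sum_integral`) shows that exceeding the budget `ε n`
costs the test little, so it must still separate `N(0, I_d)` from the mixture over `v` and the
corruption pattern.

The second moment of the likelihood ratio is the mean over independent `v, v'` of the `n`-th power
of `E exp (a a' ⟪v, v'⟫)`. The linear term vanishes by centring, which leaves at most `exp (n K ⟪v,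
v'⟫ ^ 2)` (`sum_mul_exp_le`). With one random signed entry in each of `s` blocks of size `m = ⌊d /
s⌋`, `s ⟪v, v'⟫` is a sum of `s` independent overlaps, each sub-Gaussian with variance proxy of
order `1 / (1 + log m)` (`one_add_cosh_sub_one_div_le`). Hence the second moment is close to 1
unless `n` is at least a constant times `s (1 + log m)` (`sum_mul_prod_exp_inner_le`), and
`sum_integral_gaussianProduct_le` then rules out a successful test. -/

/-! ### Gaussian likelihood ratios -/

lemma pi_withDensity_ofReal {ι : Type*} [Fintype ι] {X : ι → Type*} [∀ i, MeasurableSpace (X i)]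
    (μ : ∀ i, Measure (X i)) [∀ i, SigmaFinite (μ i)] (g : ∀ i, X i → ℝ)
    (hpos : ∀ i x, 0 ≤ g i x) (hint : ∀ i, Integrable (g i) (μ i)) :
    Measure.pi (fun i => (μ i).withDensity fun x => ENNReal.ofReal (g i x)) =
      (Measure.pi μ).withDensity fun x => ENNReal.ofReal (∏ i, g i (x i)) := by
  have : ∀ i, SigmaFinite ((μ i).withDensity fun x => ENNReal.ofReal (g i x)) :=
    fun i => SigmaFinite.withDensity_ofReal (g i)
  refine Measure.pi_eq fun s hs => ?_
  have h1 : ∀ i, Integrable (g i) ((μ i).restrict (s i)) := fun i => (hint i).restrict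
  rw [withDensity_apply _ (.univ_pi hs), Measure.restrict_pi_pi,
    ← ofReal_integral_eq_lintegral_ofReal (Integrable.fintype_prod_dep h1)
      (ae_of_all _ fun x => Finset.prod_nonneg fun i _ => hpos i _),
    integral_fintype_prod_eq_prod, ENNReal.ofReal_prod_of_nonneg
      fun i _ => integral_nonneg (hpos i)]
  refine Finset.prod_congr rfl fun i _ => ?_
  rw [withDensity_apply _ (hs i), ofReal_integral_eq_lintegral_ofReal (h1 i) (ae_of_all _ (hpos i))]

lemma gaussianReal_one_eq_withDensity (m : ℝ) :
    gaussianReal m 1 = (gaussianReal 0 1).withDensity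
      fun x => ENNReal.ofReal (Real.exp (m * x - m ^ 2 / 2)) := by
  rw [gaussianReal_of_var_ne_zero _ one_ne_zero, gaussianReal_of_var_ne_zero _ one_ne_zero,
    ← withDensity_mul _ (measurable_gaussianPDF _ _) (by fun_prop)]
  congr 1
  ext x
  simp only [Pi.mul_apply, gaussianPDF, gaussianPDFReal]
  rw [← ENNReal.ofReal_mul (by positivity), mul_assoc _ (Real.exp _), ← Real.exp_add]
  congr 3
  push_cast
  ring

/-- The density of `N(θ, I_d)` with respect to `N(0, I_d)`. -/
noncomputable def shiftDensity {d : ℕ} (θ x : EuclideanSpace ℝ (Fin d)) : ℝ :=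
  Real.exp (inner ℝ θ x - ‖θ‖ ^ 2 / 2)

@[fun_prop]
lemma measurable_shiftDensity {d : ℕ} (θ : EuclideanSpace ℝ (Fin d)) :
    Measurable (shiftDensity θ) := by
  unfold shiftDensity
  fun_prop

lemma shiftDensity_eq_prod {d : ℕ} (θ x : EuclideanSpace ℝ (Fin d)) :
    shiftDensity θ x = ∏ i, Real.exp (θ i * x i - θ i ^ 2 / 2) := by
  rw [shiftDensity, ← Real.exp_sum, Finset.sum_sub_distrib, ← Finset.sum_div,
    EuclideanSpace.real_norm_sq_eq, PiLp.inner_apply]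
  simp [mul_comm]

lemma multivariateGaussian_one_eq_map {d : ℕ} (θ θ' : EuclideanSpace ℝ (Fin d)) :
    multivariateGaussian θ' 1 =
      (multivariateGaussian θ (1 : Matrix (Fin d) (Fin d) ℝ)).map (fun x => (θ' - θ) + x) := by
  simp only [multivariateGaussian]
  rw [Measure.map_map (by fun_prop) (by fun_prop)]
  congr 1
  ext x
  simp
  ring

lemma multivariateGaussian_one_eq_withDensity {d : ℕ} (θ : EuclideanSpace ℝ (Fin d)) :
    multivariateGaussian θ 1 = (multivariateGaussian 0 1).withDensity
      fun x => ENNReal.ofReal (shiftDensity θ x) := by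
  rw [multivariateGaussian_one_eq_map 0 θ, multivariateGaussian_zero_one, ← map_pi_eq_stdGaussian,
    Measure.map_map (by fun_prop) (by fun_prop)]
  have h : (fun x : EuclideanSpace ℝ (Fin d) => θ - 0 + x) ∘ WithLp.toLp 2 =
      WithLp.toLp 2 ∘ fun (x : Fin d → ℝ) i => θ i + x i := by
    ext x i
    simp
  rw [h, ← Measure.map_map (by fun_prop) (by fun_prop)]
  have h2 := Measure.pi_map_pi (μ := fun _ : Fin d => gaussianReal 0 1)
    (f := fun i (x : ℝ) => θ i + x)
    (hμ := fun i => by rw [gaussianReal_map_const_add]; infer_instance) (by fun_prop)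
  rw [h2]
  simp_rw [gaussianReal_map_const_add, zero_add, gaussianReal_one_eq_withDensity (θ _)]
  rw [pi_withDensity_ofReal _ (fun i x => Real.exp (θ i * x - θ i ^ 2 / 2))
    (fun _ _ => (Real.exp_pos _).le)]
  · ext s hs
    rw [Measure.map_apply (by fun_prop) hs, withDensity_apply _ hs,
      withDensity_apply _ (hs.preimage (by fun_prop)), setLIntegral_map hs (by fun_prop)
        (by fun_prop)]
    simp [shiftDensity_eq_prod]
  · intro i
    simp_rw [Real.exp_sub]
    exact (integrable_exp_mul_gaussianReal _).div_const _

lemma lintegral_shiftDensity {d : ℕ} (θ : EuclideanSpace ℝ (Fin d)) :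
    ∫⁻ x, ENNReal.ofReal (shiftDensity θ x) ∂(multivariateGaussian 0 1) = 1 := by
  have h := congrArg (fun μ => μ Set.univ) (multivariateGaussian_one_eq_withDensity θ)
  simpa using h.symm

lemma shiftDensity_nonneg {d : ℕ} (θ x : EuclideanSpace ℝ (Fin d)) : 0 ≤ shiftDensity θ x :=
  (Real.exp_pos _).le

lemma integrable_shiftDensity {d : ℕ} (θ : EuclideanSpace ℝ (Fin d)) :
    Integrable (shiftDensity θ) (multivariateGaussian 0 1) := by
  refine ⟨by fun_prop, ?_⟩
  rw [hasFiniteIntegral_iff_ofReal (ae_of_all _ (shiftDensity_nonneg θ)), lintegral_shiftDensity]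
  exact ENNReal.one_lt_top

lemma integral_shiftDensity {d : ℕ} (θ : EuclideanSpace ℝ (Fin d)) :
    ∫ x, shiftDensity θ x ∂(multivariateGaussian 0 1) = 1 := by
  rw [integral_eq_lintegral_of_nonneg_ae (ae_of_all _ (shiftDensity_nonneg θ)) (by fun_prop),
    lintegral_shiftDensity, ENNReal.toReal_one]

/-- A product of two densities is a multiple of a third, so its integral can be read off; this
evaluates the second moment of a mixture. -/
lemma shiftDensity_mul {d : ℕ} (θ η x : EuclideanSpace ℝ (Fin d)) :
    shiftDensity θ x * shiftDensity η x = Real.exp (inner ℝ θ η) * shiftDensity (θ + η) x := by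
  simp only [shiftDensity, ← Real.exp_add]
  rw [norm_add_sq_real, inner_add_left]
  ring_nf

/-- The law of independent samples from Gaussians `N(θ i, I_d)`. -/
noncomputable def gaussianProduct {n d : ℕ} (θ : Fin n → EuclideanSpace ℝ (Fin d)) :
    Measure (Fin n → EuclideanSpace ℝ (Fin d)) :=
  Measure.pi fun i => multivariateGaussian (θ i) 1

/-- The density of `gaussianProduct θ` with respect to the law of `n` samples from `N(0, I_d)`. -/
noncomputable def productDensity {n d : ℕ} (θ x : Fin n → EuclideanSpace ℝ (Fin d)) : ℝ :=
  ∏ i, shiftDensity (θ i) (x i)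

@[fun_prop]
lemma measurable_productDensity {n d : ℕ} (θ : Fin n → EuclideanSpace ℝ (Fin d)) :
    Measurable (productDensity θ) := by
  unfold productDensity
  fun_prop

lemma productDensity_nonneg {n d : ℕ} (θ x : Fin n → EuclideanSpace ℝ (Fin d)) :
    0 ≤ productDensity θ x :=
  Finset.prod_nonneg fun _ _ => shiftDensity_nonneg _ _

lemma gaussianProduct_eq_withDensity {n d : ℕ} (θ : Fin n → EuclideanSpace ℝ (Fin d)) :
    gaussianProduct θ = (gaussianSamples n d 0).withDensity
      fun x => ENNReal.ofReal (productDensity θ x) := by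
  unfold gaussianProduct
  simp_rw [multivariateGaussian_one_eq_withDensity (θ _)]
  exact pi_withDensity_ofReal _ (fun i => shiftDensity (θ i))
    (fun _ => shiftDensity_nonneg _) fun _ => integrable_shiftDensity _

lemma integrable_productDensity {n d : ℕ} (θ : Fin n → EuclideanSpace ℝ (Fin d)) :
    Integrable (productDensity θ) (gaussianSamples n d 0) :=
  Integrable.fintype_prod fun i => integrable_shiftDensity (θ i)

lemma integral_productDensity {n d : ℕ} (θ : Fin n → EuclideanSpace ℝ (Fin d)) :
    ∫ x, productDensity θ x ∂(gaussianSamples n d 0) = 1 := by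
  unfold productDensity gaussianSamples
  rw [integral_fintype_prod_eq_prod fun i => shiftDensity (θ i)]
  simp only [integral_shiftDensity, Finset.prod_const_one]

lemma productDensity_mul {n d : ℕ} (θ η x : Fin n → EuclideanSpace ℝ (Fin d)) :
    productDensity θ x * productDensity η x =
      (∏ i, Real.exp (inner ℝ (θ i) (η i))) * productDensity (θ + η) x := by
  simp only [productDensity, ← Finset.prod_mul_distrib, shiftDensity_mul, Pi.add_apply]

instance {n d : ℕ} (θ : EuclideanSpace ℝ (Fin d)) :
    IsProbabilityMeasure (gaussianSamples n d θ) := by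
  unfold gaussianSamples
  infer_instance

instance {n d : ℕ} (θ : Fin n → EuclideanSpace ℝ (Fin d)) :
    IsProbabilityMeasure (gaussianProduct θ) := by
  unfold gaussianProduct
  infer_instance

lemma integral_gaussianProduct {n d : ℕ} (θ : Fin n → EuclideanSpace ℝ (Fin d))
    (f : (Fin n → EuclideanSpace ℝ (Fin d)) → ℝ) :
    ∫ x, f x ∂(gaussianProduct θ) = ∫ x, f x * productDensity θ x ∂(gaussianSamples n d 0) := by
  rw [gaussianProduct_eq_withDensity, integral_withDensity_eq_integral_toReal_smul (by fun_prop)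
    (ae_of_all _ fun _ => ENNReal.ofReal_lt_top)]
  simp [ENNReal.toReal_ofReal (productDensity_nonneg θ _), mul_comm]

/-! ### Corruption by shifting means -/

/-- An adversary turns a sample from `N(θ, I_d)` into a sample from the Gaussians `N(η i, I_d)` by
shifting the observations with `η i ≠ θ`. -/
lemma isCorruption_gaussianProduct {n d : ℕ} {ε : ℝ} (θ : EuclideanSpace ℝ (Fin d))
    (η : Fin n → EuclideanSpace ℝ (Fin d)) (h : ({i | η i ≠ θ}.ncard : ℝ) ≤ ε * n) :
    IsCorruption ε (gaussianSamples n d θ) (gaussianProduct η) := by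
  have hY : Measurable fun (x : Fin n → EuclideanSpace ℝ (Fin d)) i => (η i - θ) + x i := by
    fun_prop
  refine ⟨(gaussianSamples n d θ).map fun x => (x, fun i => (η i - θ) + x i), ?_, ?_, ?_⟩
  · rw [Measure.fst_map_prodMk hY]
    exact Measure.map_id
  · refine (Measure.snd_map_prodMk measurable_id).trans ?_
    unfold gaussianSamples gaussianProduct
    rw [Measure.pi_map_pi (μ := fun _ : Fin n => multivariateGaussian θ 1)
      (f := fun i x => (η i - θ) + x)
      (hμ := fun i => by rw [← multivariateGaussian_one_eq_map]; infer_instance) (by fun_prop)]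
    simp_rw [← multivariateGaussian_one_eq_map]
  · refine (ae_map_iff (by fun_prop) ?_).2 (ae_of_all _ fun x => ?_)
    -- As a sum of indicators, the number of changed observations is visibly measurable.
    · have hcard (p : (Fin n → EuclideanSpace ℝ (Fin d)) × (Fin n → EuclideanSpace ℝ (Fin d))) :
          ({i | p.1 i ≠ p.2 i}.ncard : ℝ) = ∑ i, if p.1 i = p.2 i then (0 : ℝ) else 1 := by
        simp [Set.ncard_eq_toFinset_card', Finset.sum_ite]
      simp_rw [hcard]
      exact measurableSet_le (Finset.measurable_sum _ fun i _ => Measurable.ite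
        (measurableSet_eq_fun (by fun_prop) (by fun_prop)) measurable_const measurable_const)
        measurable_const
    · simpa [sub_eq_zero] using h

lemma isCorruption_self {n d : ℕ} {ε : ℝ} (hε : 0 ≤ ε) (θ : EuclideanSpace ℝ (Fin d)) :
    IsCorruption ε (gaussianSamples n d θ) (gaussianSamples n d θ) :=
  isCorruption_gaussianProduct θ (fun _ => θ) (by simpa using by positivity)

/-! ### Elementary exponential estimates -/

/-- Independence in finite form; it is applied both to the `s` blocks and to the `n` observations.
-/
lemma sum_sum_prod_eq_prod_sum_sum {ι A : Type*} [Fintype ι] [DecidableEq ι] [Fintype A]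
    (h : ι → A → A → ℝ) :
    ∑ p : ι → A, ∑ p' : ι → A, ∏ i, h i (p i) (p' i) = ∏ i, ∑ q, ∑ q', h i q q' := by
  simp_rw [← Fintype.sum_prod_type', Fintype.prod_sum]
  exact ((Equiv.arrowProdEquivProdArrow ι (fun _ => A) (fun _ => A)).sum_comp
    fun x => ∏ i, h i (x.1 i) (x.2 i)).symm

lemma exp_le_one_add_add_sq_mul_exp_abs (y : ℝ) :
    Real.exp y ≤ 1 + y + y ^ 2 * Real.exp |y| := by
  have h1 : ∀ z : ℝ, Real.exp z - 1 ≤ z * Real.exp z := fun z => by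
    have h := mul_le_mul_of_nonneg_right (Real.add_one_le_exp (-z)) (Real.exp_pos z).le
    rw [← Real.exp_add, neg_add_cancel, Real.exp_zero] at h
    linarith
  rcases le_total 0 y with hy | hy
  · rw [abs_of_nonneg hy]
    nlinarith [mul_le_mul_of_nonneg_left (h1 y) hy, h1 y]
  · have h2 : 1 ≤ Real.exp |y| := Real.one_le_exp (abs_nonneg y)
    nlinarith [mul_le_mul_of_nonneg_left (Real.add_one_le_exp y) (neg_nonneg.2 hy), h1 y,
      mul_le_mul_of_nonneg_left h2 (sq_nonneg y)]

/-- For `x ≥ 0` this rests on `cosh x - 1 = (1 - exp (-x)) ^ 2 / 2 * exp x`. -/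
lemma cosh_sub_one_le (x : ℝ) : Real.cosh x - 1 ≤ x ^ 2 / 2 * Real.exp |x| := by
  wlog hx : 0 ≤ x generalizing x
  · simpa using this (-x) (by linarith)
  rw [abs_of_nonneg hx, Real.cosh_eq]
  have h1 : 0 ≤ 1 - Real.exp (-x) := by simpa using hx
  have h2 : 1 - Real.exp (-x) ≤ x := by linarith [Real.add_one_le_exp (-x)]
  have h3 : (1 - Real.exp (-x)) ^ 2 ≤ x ^ 2 := by gcongr
  have h4 : Real.exp x * Real.exp (-x) = 1 := by rw [← Real.exp_add]; simp
  have h5 : (Real.exp x + Real.exp (-x)) / 2 - 1 = (1 - Real.exp (-x)) ^ 2 / 2 * Real.exp x := by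
    linear_combination (-1 + Real.exp (-x) / 2) * (-h4)
  rw [h5]
  gcongr

/-- A variable equal to `±1` with probability `1 / (2 * m)` each and to `0` otherwise is
sub-Gaussian with variance proxy of order `1 / (1 + log m)`. -/
lemma one_add_cosh_sub_one_div_le {m : ℝ} (hm : 1 ≤ m) (x : ℝ) :
    1 + (Real.cosh x - 1) / m ≤ Real.exp (2 * x ^ 2 / (1 + Real.log m)) := by
  set L := 1 + Real.log m with hL
  have hL1 : 1 ≤ L := by linarith [Real.log_nonneg hm]
  have hmL : m = Real.exp L / Real.exp 1 := by
    rw [← Real.exp_sub, hL, add_sub_cancel_left, Real.exp_log (by linarith)]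
  have hc : 0 ≤ Real.cosh x - 1 := by linarith [Real.one_le_cosh x]
  -- Since `m = exp (L - 1)`, for `|x| ≤ L / 2` the factor `1 / m` absorbs both `exp |x|` and a
  -- factor `L`. For larger `|x|` it is dropped, because already `|x| ≤ 2 * x ^ 2 / L`.
  rcases le_total |x| (L / 2) with h | h
  · have h1 : (Real.cosh x - 1) / m ≤ x ^ 2 / L := by
      rw [div_le_div_iff₀ (by linarith) (by linarith)]
      have h2 : Real.exp |x| * L ≤ 2 * m := by
        have h3 : L ≤ 2 * (Real.exp (L / 2) / Real.exp 1) := by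
          rw [← Real.exp_sub]
          linarith [Real.add_one_le_exp (L / 2 - 1)]
        have h4 : Real.exp L = Real.exp (L / 2) * Real.exp (L / 2) := by
          rw [← Real.exp_add, add_halves]
        calc Real.exp |x| * L ≤ Real.exp (L / 2) * (2 * (Real.exp (L / 2) / Real.exp 1)) := by
              gcongr
          _ = 2 * m := by rw [hmL, h4]; ring
      calc (Real.cosh x - 1) * L ≤ x ^ 2 / 2 * Real.exp |x| * L := by
            gcongr; exact cosh_sub_one_le x
        _ = x ^ 2 / 2 * (Real.exp |x| * L) := by ring
        _ ≤ x ^ 2 / 2 * (2 * m) := by gcongr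
        _ = x ^ 2 * m := by ring
    have h2 : x ^ 2 / L ≤ 2 * x ^ 2 / L := by gcongr; nlinarith [sq_nonneg x]
    linarith [Real.add_one_le_exp (2 * x ^ 2 / L)]
  · have h1 : (Real.cosh x - 1) / m ≤ Real.cosh x - 1 := div_le_self hc hm
    have h2 : Real.cosh x ≤ Real.exp |x| := by
      rw [← Real.cosh_abs, Real.cosh_eq]
      linarith [Real.exp_le_exp.2 (show -|x| ≤ |x| by linarith [abs_nonneg x])]
    have h3 : |x| ≤ 2 * x ^ 2 / L := by
      rw [le_div_iff₀ (by linarith), ← sq_abs]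
      nlinarith [abs_nonneg x]
    linarith [Real.exp_le_exp.2 h3]

/-! ### Exponential moment of the squared overlap -/

lemma integral_exp_sq_gaussianReal {η : ℝ} (hη : η < 1 / 2) :
    ∫ g, Real.exp (η * g ^ 2) ∂(gaussianReal 0 1) = (√(1 - 2 * η))⁻¹ := by
  rw [integral_gaussianReal_eq_integral_smul one_ne_zero]
  have h (x : ℝ) : gaussianPDFReal 0 1 x • Real.exp (η * x ^ 2) =
      (√(2 * Real.pi))⁻¹ * Real.exp (-(1 / 2 - η) * x ^ 2) := by
    rw [smul_eq_mul, gaussianPDFReal, mul_assoc _ (Real.exp _), ← Real.exp_add,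
      NNReal.coe_one, mul_one]
    ring_nf
  simp_rw [h]
  rw [integral_const_mul, integral_gaussian, ← Real.sqrt_inv, ← Real.sqrt_inv,
    ← Real.sqrt_mul (by positivity)]
  congr 1
  have : 1 - 2 * η ≠ 0 := by linarith
  have : 1 / 2 - η ≠ 0 := by linarith
  field_simp

/-- Gaussian linearisation: `S` enters the exponent linearly, so a sum of independent terms
factorises under the integral. -/
lemma exp_mul_sq_eq_integral {μ : ℝ} (hμ : 0 ≤ μ) (S : ℝ) :
    Real.exp (μ * S ^ 2) = ∫ g, Real.exp (√(2 * μ) * S * g) ∂(gaussianReal 0 1) := by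
  have h := congrFun (mgf_fun_id_gaussianReal (μ := 0) (v := 1)) (√(2 * μ) * S)
  rw [mgf] at h
  rw [h, mul_pow, Real.sq_sqrt (by positivity)]
  norm_num
  ring

/-- The sign encoded by a Boolean. -/
def sign (b : Bool) : ℝ := if b then 1 else -1

/-- The product of the signs of two signed positions if the positions agree, and `0` otherwise. -/
def overlap {m : ℕ} (q q' : Fin m × Bool) : ℝ := if q.1 = q'.1 then sign q.2 * sign q'.2 else 0

lemma sum_exp_mul_overlap {m : ℕ} (hm : 1 ≤ m) (x : ℝ) :
    ∑ q : Fin m × Bool, ∑ q' : Fin m × Bool,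
      ((2 * m : ℝ)⁻¹ * (2 * m : ℝ)⁻¹ * Real.exp (x * overlap q q')) =
      1 + (Real.cosh x - 1) / m := by
  have hm' : (m : ℝ) ≠ 0 := by positivity
  have h (q : Fin m × Bool) : ∑ q' : Fin m × Bool, Real.exp (x * overlap q q') =
      2 * (m - 1) + 2 * Real.cosh x := by
    have h1 (l : Fin m) : ∑ b, Real.exp (x * overlap q (l, b)) =
        2 + if q.1 = l then 2 * Real.cosh x - 2 else 0 := by
      rcases q with ⟨k, c⟩
      by_cases hk : k = l
      · cases c <;> simp [overlap, sign, hk, Real.cosh_eq] <;> ring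
      · simp [overlap, hk]
    rw [Fintype.sum_prod_type]
    simp_rw [h1]
    rw [Finset.sum_add_distrib]
    simp
    ring
  simp_rw [← Finset.mul_sum, h]
  simp
  field_simp
  ring

lemma sum_exp_mul_sum_overlap_sq_le {s m : ℕ} (hm : 1 ≤ m) {μ η : ℝ} (hμ : 0 ≤ μ)
    (hη : 4 * μ * s / (1 + Real.log m) ≤ η) (hη' : η < 1 / 2) :
    ∑ p : Fin s → Fin m × Bool, ∑ p' : Fin s → Fin m × Bool,
      ((2 * m : ℝ)⁻¹ ^ s * (2 * m : ℝ)⁻¹ ^ s * Real.exp (μ * (∑ i, overlap (p i) (p' i)) ^ 2)) ≤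
      (√(1 - 2 * η))⁻¹ := by
  have hint (p p' : Fin s → Fin m × Bool) : Integrable
      (fun g => (2 * m : ℝ)⁻¹ ^ s * (2 * m : ℝ)⁻¹ ^ s *
        Real.exp (√(2 * μ) * (∑ i, overlap (p i) (p' i)) * g)) (gaussianReal 0 1) :=
    (integrable_exp_mul_gaussianReal _).const_mul _
  simp_rw [exp_mul_sq_eq_integral hμ, ← integral_const_mul]
  simp_rw [← integral_finsetSum _ fun p' _ => hint _ p']
  rw [← integral_finsetSum _ fun p _ => integrable_finsetSum _ fun p' _ => hint p p',
    ← integral_exp_sq_gaussianReal hη']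
  refine integral_mono_of_nonneg (ae_of_all _ fun g => by positivity) ?_ (ae_of_all _ fun g => ?_)
  -- A non-integrable function would have integral 0 by convention, whereas this integral is known
  -- to be positive.
  · refine Integrable.of_integral_ne_zero ?_
    rw [integral_exp_sq_gaussianReal hη']
    have : 0 < 1 - 2 * η := by linarith
    positivity
  have h (p p' : Fin s → Fin m × Bool) : (2 * m : ℝ)⁻¹ ^ s * (2 * m : ℝ)⁻¹ ^ s *
      Real.exp (√(2 * μ) * (∑ i, overlap (p i) (p' i)) * g) =
      ∏ i, ((2 * m : ℝ)⁻¹ * (2 * m : ℝ)⁻¹ * Real.exp (√(2 * μ) * g * overlap (p i) (p' i))) := by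
    rw [Finset.prod_mul_distrib, ← Real.exp_sum, ← Finset.mul_sum, Finset.prod_const,
      Finset.card_univ, Fintype.card_fin, mul_pow]
    ring_nf
  simp only [h]
  rw [sum_sum_prod_eq_prod_sum_sum fun _ q q' =>
    (2 * m : ℝ)⁻¹ * (2 * m : ℝ)⁻¹ * Real.exp (√(2 * μ) * g * overlap q q')]
  simp_rw [sum_exp_mul_overlap hm]
  have hm1 : (1 : ℝ) ≤ m := by exact_mod_cast hm
  have hpos : 0 ≤ 1 + (Real.cosh (√(2 * μ) * g) - 1) / m := by
    have := Real.one_le_cosh (√(2 * μ) * g)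
    have : 0 ≤ (Real.cosh (√(2 * μ) * g) - 1) / m := div_nonneg (by linarith) (by linarith)
    linarith
  calc ∏ _i : Fin s, (1 + (Real.cosh (√(2 * μ) * g) - 1) / m)
      ≤ ∏ _i : Fin s, Real.exp (2 * (√(2 * μ) * g) ^ 2 / (1 + Real.log m)) :=
        Finset.prod_le_prod (fun _ _ => hpos) fun _ _ => one_add_cosh_sub_one_div_le hm1 _
    _ = Real.exp (4 * μ * s / (1 + Real.log m) * g ^ 2) := by
        rw [← Real.exp_sum, mul_pow, Real.sq_sqrt (by positivity)]
        simp
        ring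
    _ ≤ Real.exp (η * g ^ 2) := by gcongr

/-! ### The second-moment method -/

/-- Centring of `a` kills the term linear in `t`, so the exponent is of order `t ^ 2`. This is where
the corruption helps the adversary. -/
lemma sum_mul_exp_le {B : Type*} [Fintype B] {w a : B → ℝ} (hw : ∀ b, 0 ≤ w b)
    (hw1 : ∑ b, w b = 1) (hwa : ∑ b, w b * a b = 0) {A : ℝ} (ha : ∀ b, |a b| ≤ A) {t : ℝ}
    (ht : |t| ≤ 1) :
    ∑ b, ∑ b', (w b * w b' * Real.exp (a b * a b' * t)) ≤
      Real.exp (A ^ 4 * Real.exp (A ^ 2) * t ^ 2) := by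
  have h (b b' : B) : Real.exp (a b * a b' * t) ≤
      1 + a b * a b' * t + A ^ 4 * Real.exp (A ^ 2) * t ^ 2 := by
    have hA : 0 ≤ A := (abs_nonneg _).trans (ha b)
    have h1 : |a b * a b'| ≤ A ^ 2 := by
      rw [abs_mul, pow_two]
      exact mul_le_mul (ha b) (ha b') (abs_nonneg _) hA
    have h2 : |a b * a b' * t| ≤ A ^ 2 := by
      rw [abs_mul]
      exact (mul_le_of_le_one_right (abs_nonneg _) ht).trans h1
    have h3 : (a b * a b' * t) ^ 2 ≤ A ^ 4 * t ^ 2 := by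
      rw [mul_pow, ← sq_abs (a b * a b'), show A ^ 4 = (A ^ 2) ^ 2 by ring]
      gcongr
    calc Real.exp (a b * a b' * t)
        ≤ 1 + a b * a b' * t + (a b * a b' * t) ^ 2 * Real.exp |a b * a b' * t| :=
          exp_le_one_add_add_sq_mul_exp_abs _
      _ ≤ 1 + a b * a b' * t + A ^ 4 * t ^ 2 * Real.exp (A ^ 2) := by gcongr
      _ = _ := by ring
  set K := A ^ 4 * Real.exp (A ^ 2) * t ^ 2
  calc ∑ b, ∑ b', (w b * w b' * Real.exp (a b * a b' * t))
      ≤ ∑ b, ∑ b', (w b * w b' * (1 + a b * a b' * t + K)) := by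
        gcongr with b _ b' _
        · exact mul_nonneg (hw b) (hw b')
        · exact h b b'
    _ = (∑ b, w b) * (∑ b, w b) * (1 + K) + t * ((∑ b, w b * a b) * ∑ b, w b * a b) := by
        simp_rw [Finset.sum_mul_sum, Finset.mul_sum, Finset.sum_mul, ← Finset.sum_add_distrib]
        refine Finset.sum_congr rfl fun b _ => Finset.sum_congr rfl fun b' _ => ?_
        ring
    _ = K + 1 := by rw [hw1, hwa]; ring
    _ ≤ Real.exp K := Real.add_one_le_exp K

/-- A second-moment bound for the mixture of the laws `gaussianProduct (θ j)` with weights `W j`. -/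
lemma sum_integral_gaussianProduct_le {J : Type*} [Fintype J] {n d : ℕ} {W : J → ℝ}
    (hW1 : ∑ j, W j = 1)
    (θ : J → Fin n → EuclideanSpace ℝ (Fin d)) {f : (Fin n → EuclideanSpace ℝ (Fin d)) → ℝ}
    (hf : Measurable f) (hf0 : ∀ x, 0 ≤ f x) (hf1 : ∀ x, f x ≤ 1) :
    ∑ j, W j * ∫ x, f x ∂(gaussianProduct (θ j)) ≤ ∫ x, f x ∂(gaussianSamples n d 0) +
      2 * (∑ j, ∑ k, W j * W k * ∏ i, Real.exp (inner ℝ (θ j i) (θ k i)) - 1) + 1 / 8 := by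
  set P := gaussianSamples n d 0
  set L : (Fin n → EuclideanSpace ℝ (Fin d)) → ℝ := fun x => ∑ j, W j * productDensity (θ j) x
    with hL
  have hLsq (x) : L x ^ 2 = ∑ j, ∑ k, W j * W k * (∏ i, Real.exp (inner ℝ (θ j i) (θ k i))) *
      productDensity (θ j + θ k) x := by
    rw [hL, pow_two, Finset.sum_mul_sum]
    refine Finset.sum_congr rfl fun j _ => Finset.sum_congr rfl fun k _ => ?_
    rw [mul_assoc (W j * W k), ← productDensity_mul]
    ring
  have hfint : Integrable f P :=
    Integrable.of_bound hf.aestronglyMeasurable 1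
      (ae_of_all _ fun x => by rw [Real.norm_of_nonneg (hf0 x)]; exact hf1 x)
  have hLint : Integrable L P :=
    integrable_finsetSum _ fun j _ => (integrable_productDensity _).const_mul _
  have hsqint (j k) : Integrable (fun x => W j * W k *
      (∏ i, Real.exp (inner ℝ (θ j i) (θ k i))) * productDensity (θ j + θ k) x) P :=
    (integrable_productDensity _).const_mul _
  have hLsqint : Integrable (fun x => L x ^ 2) P := by
    simp_rw [hLsq]
    exact integrable_finsetSum _ fun j _ => integrable_finsetSum _ fun k _ => hsqint j k
  have hfd (j) : Integrable (fun x => f x * productDensity (θ j) x) P :=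
    (integrable_productDensity (θ j)).bdd_mul hf.aestronglyMeasurable
      (ae_of_all _ fun x => by rw [Real.norm_of_nonneg (hf0 x)]; exact hf1 x)
  have hiL : ∫ x, L x ∂P = 1 := by
    rw [hL, integral_finsetSum _ fun j _ => (integrable_productDensity _).const_mul _]
    simp_rw [integral_const_mul]
    simp [integral_productDensity, hW1]
  have hiLsq : ∫ x, L x ^ 2 ∂P =
      ∑ j, ∑ k, W j * W k * ∏ i, Real.exp (inner ℝ (θ j i) (θ k i)) := by
    simp_rw [hLsq]
    rw [integral_finsetSum _ fun j _ => integrable_finsetSum _ fun k _ => hsqint j k]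
    simp_rw [integral_finsetSum _ fun k _ => hsqint _ k, integral_const_mul]
    simp [P, integral_productDensity]
  have hfL : ∑ j, W j * ∫ x, f x ∂(gaussianProduct (θ j)) = ∫ x, f x * L x ∂P := by
    simp_rw [integral_gaussianProduct, ← integral_const_mul]
    rw [← integral_finsetSum _ fun j _ => (hfd j).const_mul _]
    simp_rw [hL, Finset.mul_sum]
    congr 1 with x
    exact Finset.sum_congr rfl fun j _ => by ring
  have hbound : ∫ x, f x * L x ∂P ≤ ∫ x, (f x + 2 * (L x ^ 2 - 2 * L x + 1) + 1 / 8) ∂P := by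
    refine integral_mono (hLint.bdd_mul hf.aestronglyMeasurable
      (ae_of_all _ fun x => by rw [Real.norm_of_nonneg (hf0 x)]; exact hf1 x))
      ((hfint.add (((hLsqint.sub (hLint.const_mul 2)).add (integrable_const 1)).const_mul 2)).add
        (integrable_const _)) fun x => ?_
    have := hf0 x
    have := hf1 x
    dsimp only
    -- The square gives `f * (L - 1) ≤ 2 * (L - 1) ^ 2 + f ^ 2 / 8`, and `f ^ 2 ≤ 1`.
    nlinarith [sq_nonneg (4 * (L x - 1) - f x)]
  rw [hfL]
  refine hbound.trans_eq ?_
  rw [integral_add, integral_add, integral_const_mul, integral_add, integral_sub,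
    integral_const_mul, hiL, hiLsq]
  · simp
    ring
  all_goals first
    | exact hfint | exact hLsqint | exact hLint.const_mul 2 | exact integrable_const _
    | exact hLsqint.sub (hLint.const_mul 2)
    | exact ((hLsqint.sub (hLint.const_mul 2)).add (integrable_const 1)).const_mul 2
    | exact hfint.add (((hLsqint.sub (hLint.const_mul 2)).add (integrable_const 1)).const_mul 2)

/-! ### The sparse prior -/

/-- The sparse unit vector with one entry `± 1 / √s` in each block. -/
noncomputable def sparseVector {s m d : ℕ} (e : Fin s × Fin m ↪ Fin d)
    (p : Fin s → Fin m × Bool) : EuclideanSpace ℝ (Fin d) :=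
  ∑ i, (sign (p i).2 / √s) • EuclideanSpace.single (e (i, (p i).1)) (1 : ℝ)

lemma inner_sparseVector {s m d : ℕ} (e : Fin s × Fin m ↪ Fin d) (p p' : Fin s → Fin m × Bool) :
    inner ℝ (sparseVector e p) (sparseVector e p') = (∑ i, overlap (p i) (p' i)) / s := by
  simp only [sparseVector, sum_inner, inner_sum, real_inner_smul_left, real_inner_smul_right]
  simp only [EuclideanSpace.inner_single_left, PiLp.single_apply,
    EmbeddingLike.apply_eq_iff_eq, Prod.mk.injEq, Finset.sum_div]
  refine Finset.sum_congr rfl fun i _ => ?_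
  rw [Finset.sum_eq_single i (fun j _ hj => by simp [hj]) (by simp)]
  have hs : √(s : ℝ) * √s = s := Real.mul_self_sqrt (by positivity)
  by_cases h : (p i).1 = (p' i).1
  · simp [overlap, h, div_mul_div_comm, hs, mul_comm]
  · simp [overlap, h]

lemma norm_sparseVector {s m d : ℕ} (hs : 1 ≤ s) (e : Fin s × Fin m ↪ Fin d)
    (p : Fin s → Fin m × Bool) : ‖sparseVector e p‖ = 1 := by
  have h : inner ℝ (sparseVector e p) (sparseVector e p) = (1 : ℝ) := by
    have hs' : (s : ℝ) ≠ 0 := by positivity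
    have h1 (i : Fin s) : overlap (p i) (p i) = 1 := by
      cases h : (p i).2 <;> simp [overlap, sign, h]
    rw [inner_sparseVector]
    simp [h1, hs']
  rw [real_inner_self_eq_norm_sq] at h
  exact (pow_eq_one_iff_of_nonneg (norm_nonneg _) two_ne_zero).1 h

lemma numNonzero_smul_sparseVector_le {s m d : ℕ} (e : Fin s × Fin m ↪ Fin d)
    (p : Fin s → Fin m × Bool) (c : ℝ) : numNonzero (c • sparseVector e p) ≤ s := by
  have h : {k | (c • sparseVector e p) k ≠ 0} ⊆ Set.range fun i => e (i, (p i).1) := by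
    intro k hk
    by_contra hk'
    refine hk ?_
    simp only [Set.mem_range, not_exists] at hk'
    simp [sparseVector, fun i => Ne.symm (hk' i)]
  calc numNonzero (c • sparseVector e p) ≤ (Set.range fun i => e (i, (p i).1)).ncard :=
        Set.ncard_le_ncard h
    _ ≤ s := by
        rw [← Set.image_univ]
        exact (Set.ncard_image_le).trans (by simp)

/-- The expected number of corrupted observations when each is corrupted independently. -/
lemma sum_prod_mul_card {n : ℕ} {w : Bool → ℝ} (hw1 : ∑ b, w b = 1) :
    ∑ b : Fin n → Bool, (∏ i, w (b i)) * ∑ i, (if b i then (1 : ℝ) else 0) = n * w true := by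
  simp_rw [Finset.mul_sum]
  rw [Finset.sum_comm]
  have h (i : Fin n) : ∑ b : Fin n → Bool, (∏ j, w (b j)) * (if b i then (1 : ℝ) else 0) =
      w true := by
    have h1 (b : Fin n → Bool) : (∏ j, w (b j)) * (if b i then (1 : ℝ) else 0) =
        ∏ j, w (b j) * if j = i then (if b j then (1 : ℝ) else 0) else 1 := by
      rw [Finset.prod_mul_distrib]
      simp
    simp_rw [h1]
    rw [← Fintype.prod_sum fun j c => w c * if j = i then (if c then (1 : ℝ) else 0) else 1,
      Finset.prod_eq_single i]
    · simp
    · intro j _ hj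
      simpa [hj] using hw1
    · simp
  rw [Finset.sum_congr rfl fun i _ => h i]
  simp

lemma sum_mul_prod_exp_inner_le {n s m d : ℕ} (hs : 1 ≤ s) (hm : 1 ≤ m)
    (e : Fin s × Fin m ↪ Fin d) {w a : Bool → ℝ} (hw : ∀ b, 0 ≤ w b)
    (hw1 : ∑ b, w b = 1) (hwa : ∑ b, w b * a b = 0) {A : ℝ} (ha : ∀ b, |a b| ≤ A)
    (hn : 80 * (n * (A ^ 4 * Real.exp (A ^ 2))) ≤ s * (1 + Real.log m)) :
    ∑ j : (Fin s → Fin m × Bool) × (Fin n → Bool), ∑ k : (Fin s → Fin m × Bool) × (Fin n → Bool),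
      ((2 * m : ℝ)⁻¹ ^ s * ∏ i, w (j.2 i)) * ((2 * m : ℝ)⁻¹ ^ s * ∏ i, w (k.2 i)) *
        ∏ i, Real.exp (inner ℝ (a (j.2 i) • sparseVector e j.1) (a (k.2 i) • sparseVector e k.1)) ≤
      (√(1 - 2 * (1 / 20)))⁻¹ := by
  set K := A ^ 4 * Real.exp (A ^ 2)
  have hs0 : (0 : ℝ) < s := by exact_mod_cast hs
  have hL : 0 < 1 + Real.log m := by
    linarith [Real.log_nonneg (show (1 : ℝ) ≤ m by exact_mod_cast hm)]
  have hK : 0 ≤ K := by positivity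
  -- As `⟪v, v'⟫` is the total overlap divided by `s`, `μ = n K / s ^ 2`; then `4 μ s / (1 + log m)
  -- ≤ 1 / 20` is exactly the condition with the constant 80.
  refine le_trans ?_ (sum_exp_mul_sum_overlap_sq_le (s := s) (m := m) hm (μ := n * K / s ^ 2)
    (by positivity) ?_ (by norm_num))
  swap
  · rw [div_le_iff₀ hL, mul_div_assoc', div_mul_eq_mul_div, div_le_iff₀ (by positivity)]
    nlinarith [mul_le_mul_of_nonneg_right hn hs0.le]
  simp_rw [Fintype.sum_prod_type]
  gcongr with p _
  rw [Finset.sum_comm]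
  gcongr with p' _
  set t : ℝ := inner ℝ (sparseVector e p) (sparseVector e p') with ht
  have ht1 : |t| ≤ 1 := by
    simpa [norm_sparseVector hs] using
      abs_real_inner_le_norm (sparseVector e p) (sparseVector e p')
  have hterm (b b' : Fin n → Bool) :
      ((2 * m : ℝ)⁻¹ ^ s * ∏ i, w (b i)) * ((2 * m : ℝ)⁻¹ ^ s * ∏ i, w (b' i)) *
        ∏ i, Real.exp (inner ℝ (a (b i) • sparseVector e p) (a (b' i) • sparseVector e p')) =
      (2 * m : ℝ)⁻¹ ^ s * (2 * m : ℝ)⁻¹ ^ s *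
        ∏ i, (w (b i) * w (b' i) * Real.exp (a (b i) * a (b' i) * t)) := by
    simp_rw [real_inner_smul_left, real_inner_smul_right, Finset.prod_mul_distrib, ← mul_assoc,
      ← ht]
    ring
  simp_rw [hterm, ← Finset.mul_sum]
  gcongr
  rw [sum_sum_prod_eq_prod_sum_sum fun _ b b' => w b * w b' * Real.exp (a b * a b' * t)]
  calc ∏ _i : Fin n, ∑ b, ∑ b', (w b * w b' * Real.exp (a b * a b' * t))
      ≤ ∏ _i : Fin n, Real.exp (K * t ^ 2) :=
        Finset.prod_le_prod (fun _ _ => Finset.sum_nonneg fun b _ => Finset.sum_nonneg fun b' _ =>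
          mul_nonneg (mul_nonneg (hw b) (hw b')) (Real.exp_pos _).le)
          fun _ _ => sum_mul_exp_le hw hw1 hwa ha ht1
    _ = Real.exp (n * K / s ^ 2 * (∑ i, overlap (p i) (p' i)) ^ 2) := by
        rw [← Real.exp_sum, ht, inner_sparseVector]
        simp
        ring

/-! ### From a robust test to the sample size -/

lemma toReal_bind_apply {α : Type*} [MeasurableSpace α] (Q : Measure α) [IsFiniteMeasure Q]
    (T : Kernel α Bool) [IsMarkovKernel T] (b : Bool) :
    ((Q.bind T) {b}).toReal = ∫ x, (T x).real {b} ∂Q := by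
  rw [Measure.bind_apply (.of_discrete) T.aemeasurable]
  simp_rw [Measure.real_def]
  rw [integral_toReal (T.measurable_coe .of_discrete).aemeasurable
      (ae_of_all _ fun _ => measure_lt_top _ _)]

lemma Distinguishes.integral_lt {ε γ : ℝ} (hε : 0 ≤ ε) {n d s : ℕ}
    {T : Kernel (Fin n → EuclideanSpace ℝ (Fin d)) Bool} [IsMarkovKernel T]
    (hT : Distinguishes ε γ s T) :
    ∫ x, (T x).real {true} ∂(gaussianSamples n d 0) < 1 / 3 := by
  have h := ENNReal.toReal_strict_mono (measure_ne_top _ _) (hT.1 _ (isCorruption_self hε 0))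
  rw [toReal_bind_apply] at h
  have h1 (x) : (T x).real {false} = 1 - (T x).real {true} := by
    rw [← probReal_compl_eq_one_sub .of_discrete]
    congr 1
    ext b
    simp
  simp_rw [h1] at h
  have hint : Integrable (fun x => (T x).real {true}) (gaussianSamples n d 0) := .of_bound
    (T.measurable_coe .of_discrete).ennreal_toReal.aestronglyMeasurable 1
    (ae_of_all _ fun x => by
      rw [Real.norm_of_nonneg measureReal_nonneg]; exact measureReal_le_one)
  rw [integral_sub (integrable_const _) hint] at h
  norm_num at h
  linarith

lemma Distinguishes.lt_integral {ε γ : ℝ} {n d s : ℕ}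
    {T : Kernel (Fin n → EuclideanSpace ℝ (Fin d)) Bool} [IsMarkovKernel T]
    (hT : Distinguishes ε γ s T) {θ : EuclideanSpace ℝ (Fin d)} (hθ : γ ≤ ‖θ‖)
    (hθs : numNonzero θ ≤ s) (η : Fin n → EuclideanSpace ℝ (Fin d))
    (h : ({i | η i ≠ θ}.ncard : ℝ) ≤ ε * n) :
    2 / 3 < ∫ x, (T x).real {true} ∂(gaussianProduct η) := by
  have h := ENNReal.toReal_strict_mono (measure_ne_top _ _)
    (hT.2 θ hθ hθs _ (isCorruption_gaussianProduct θ η h))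
  rw [toReal_bind_apply] at h
  simpa using h

/-- Rounding costs at most a factor `e`: `d / s ≤ ⌊d / s⌋ + 1 ≤ 2 ⌊d / s⌋ ≤ e ⌊d / s⌋`. -/
lemma log_exp_one_mul_div_le {d s : ℕ} (hs : 1 ≤ s) (hsd : s ≤ d) :
    Real.log (Real.exp 1 * d / s) ≤ 2 * (1 + Real.log (d / s : ℕ)) := by
  have hm : 1 ≤ d / s := (Nat.one_le_div_iff hs).2 hsd
  have hm1 : (1 : ℝ) ≤ (d / s : ℕ) := by exact_mod_cast hm
  have hs0 : (0 : ℝ) < s := by exact_mod_cast hs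
  have hd0 : (0 : ℝ) < d := by exact_mod_cast hs.trans hsd
  have hd : (d : ℝ) / s ≤ Real.exp 1 * (d / s : ℕ) := by
    have h1 : d < s * (d / s + 1) := Nat.lt_mul_div_succ d hs
    have h2 : (d : ℝ) ≤ s * ((d / s : ℕ) + 1) := by exact_mod_cast h1.le
    rw [div_le_iff₀ hs0]
    nlinarith [Real.add_one_le_exp 1, mul_le_mul_of_nonneg_right hm1 hs0.le,
      mul_le_mul_of_nonneg_right (Real.add_one_le_exp 1) (mul_nonneg (zero_le_one.trans hm1) hs0.le)]
  rw [mul_div_assoc, Real.log_mul (by positivity) (by positivity), Real.log_exp]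
  have h := Real.log_le_log (by positivity) hd
  rw [Real.log_mul (by positivity) (by positivity), Real.log_exp] at h
  linarith [Real.log_nonneg hm1]

/-- If a test works against every adversary that corrupts at most `ε n` observations, then it works
on average against the adversary that corrupts each observation independently with a probability
`w true ≤ ε / 10`. -/
lemma Distinguishes.le_sum_integral {ε γ : ℝ} (hε : 0 < ε) {n d s : ℕ}
    {T : Kernel (Fin n → EuclideanSpace ℝ (Fin d)) Bool} [IsMarkovKernel T]
    (hT : Distinguishes ε γ s T) {v : EuclideanSpace ℝ (Fin d)} {w a : Bool → ℝ}
    (hv : γ ≤ ‖a false • v‖) (hvs : numNonzero (a false • v) ≤ s) (hw : ∀ b, 0 ≤ w b)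
    (hw1 : ∑ b, w b = 1) (hwε : w true ≤ ε / 10) :
    3 / 5 ≤ ∑ b : Fin n → Bool, (∏ i, w (b i)) *
      ∫ x, (T x).real {true} ∂(gaussianProduct fun i => a (b i) • v) := by
  -- Markov's inequality as a pointwise bound: the left side is at most `2 / 3` within the budget
  -- and negative beyond it. Averaging loses a factor `9 / 10`, whence `3 / 5`. For `n = 0` the
  -- quotient is 0.
  have key (b : Fin n → Bool) : 2 / 3 * (1 - (∑ i, if b i then (1 : ℝ) else 0) / (ε * n)) ≤
      ∫ x, (T x).real {true} ∂(gaussianProduct fun i => a (b i) • v) := by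
    have hcount : (∑ i, if b i then (1 : ℝ) else 0) = {i | b i = true}.ncard := by
      simp [Set.ncard_eq_toFinset_card']
    rw [hcount]
    rcases le_or_gt (({i | b i = true}.ncard : ℕ) : ℝ) (ε * n) with h | h
    · have hsub : {i | a (b i) • v ≠ a false • v} ⊆ {i | b i = true} := by
        intro i hi
        by_contra hb
        simp only [Set.mem_ofPred_eq, Bool.not_eq_true] at hb
        exact hi (by rw [hb])
      have h1 : ({i | a (b i) • v ≠ a false • v}.ncard : ℝ) ≤ ε * n :=
        le_trans (by exact_mod_cast Set.ncard_le_ncard hsub) h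
      have h2 := hT.lt_integral hv hvs (fun i => a (b i) • v) h1
      have h3 : 0 ≤ ({i | b i = true}.ncard : ℝ) / (ε * n) := by positivity
      linarith
    · have h0 : 0 < n := by
        rcases Nat.eq_zero_or_pos n with rfl | hn
        · rw [Set.eq_empty_of_isEmpty {i | b i = true}] at h
          simp at h
        · exact hn
      have h1 : 1 < ({i | b i = true}.ncard : ℝ) / (ε * n) := (one_lt_div (by positivity)).2 h
      have h2 : 0 ≤ ∫ x, (T x).real {true} ∂(gaussianProduct fun i => a (b i) • v) :=
        integral_nonneg fun _ => measureReal_nonneg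
      linarith
  have hsum1 : ∑ b : Fin n → Bool, ∏ i, w (b i) = 1 := by
    rw [← Fintype.prod_sum fun _ : Fin n => w, hw1]
    simp
  calc (3 / 5 : ℝ) ≤ 2 / 3 * (1 - n * w true / (ε * n)) := by
        have : n * w true / (ε * n) ≤ 1 / 10 := by
          refine div_le_of_le_mul₀ (by positivity) (by norm_num) ?_
          nlinarith [mul_le_mul_of_nonneg_left hwε (Nat.cast_nonneg (α := ℝ) n)]
        linarith
    _ = ∑ b : Fin n → Bool, (∏ i, w (b i)) *
          (2 / 3 * (1 - (∑ i, if b i then (1 : ℝ) else 0) / (ε * n))) := by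
        simp_rw [mul_sub, Finset.sum_sub_distrib, ← Finset.sum_mul, hsum1,
          ← sum_prod_mul_card hw1, Finset.sum_div, Finset.mul_sum]
        congr 1
        · ring
        · exact Finset.sum_congr rfl fun b _ => by
            simp only [Finset.sum_div, Finset.mul_sum]
            exact Finset.sum_congr rfl fun i _ => by ring
    _ ≤ _ := by
        gcongr with b _
        · exact Finset.prod_nonneg fun i _ => hw _
        · exact key b

lemma Distinguishes.lt_mul_sample_size {ε γ : ℝ} (hε : 0 < ε) {n d s : ℕ} (hs : 1 ≤ s)
    (hsd : s ≤ d) {T : Kernel (Fin n → EuclideanSpace ℝ (Fin d)) Bool} [IsMarkovKernel T]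
    (hT : Distinguishes ε γ s T) {w a : Bool → ℝ} (hw : ∀ b, 0 ≤ w b) (hw1 : ∑ b, w b = 1)
    (hwa : ∑ b, w b * a b = 0) (hwε : w true ≤ ε / 10) (haγ : γ ≤ a false) {A : ℝ}
    (ha : ∀ b, |a b| ≤ A) :
    s * (1 + Real.log (d / s : ℕ)) < 80 * (n * (A ^ 4 * Real.exp (A ^ 2))) := by
  by_contra! hn
  set m := d / s
  have hm : 1 ≤ m := (Nat.one_le_div_iff hs).2 hsd
  have hm0 : (m : ℝ) ≠ 0 := by positivity
  obtain ⟨e⟩ : Nonempty (Fin s × Fin m ↪ Fin d) :=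
    Function.Embedding.nonempty_of_card_le (by simpa using Nat.mul_div_le d s)
  let W : (Fin s → Fin m × Bool) × (Fin n → Bool) → ℝ :=
    fun j => (2 * m : ℝ)⁻¹ ^ s * ∏ i, w (j.2 i)
  have hprior : ∑ _p : Fin s → Fin m × Bool, (2 * m : ℝ)⁻¹ ^ s = 1 := by
    simp only [Finset.sum_const, Finset.card_univ, Fintype.card_pi, Fintype.card_prod,
      Fintype.card_fin, Fintype.card_bool, Finset.prod_const, nsmul_eq_mul]
    push_cast
    rw [← mul_pow]
    field_simp
    simp
  have hW1 : ∑ j, W j = 1 := by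
    simp only [W, Fintype.sum_prod_type, ← Finset.mul_sum]
    rw [← Fintype.prod_sum fun _ : Fin n => w, hw1]
    simpa only [Finset.prod_const_one, Finset.mul_sum, mul_one] using hprior
  have h1 := sum_integral_gaussianProduct_le (n := n) hW1
    (fun j i => a (j.2 i) • sparseVector e j.1) (f := fun x => (T x).real {true})
    (T.measurable_coe .of_discrete).ennreal_toReal (fun _ => measureReal_nonneg)
    (fun _ => measureReal_le_one)
  have h2 := sum_mul_prod_exp_inner_le hs hm e hw hw1 hwa ha hn
  have h3 := hT.integral_lt hε.le
  -- The numerical contradiction is `1 / 3 + 2 * 0.055 + 1 / 8 < 3 / 5`.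
  have h4 : (√(1 - 2 * (1 / 20) : ℝ))⁻¹ ≤ 1.055 := by
    refine inv_le_of_inv_le₀ (by norm_num) (Real.le_sqrt_of_sq_le ?_)
    norm_num
  have h5 : 3 / 5 ≤ ∑ j, W j * ∫ x, (T x).real {true}
      ∂(gaussianProduct fun i => a (j.2 i) • sparseVector e j.1) := by
    rw [Fintype.sum_prod_type]
    calc (3 / 5 : ℝ) = ∑ _p : Fin s → Fin m × Bool, (2 * m : ℝ)⁻¹ ^ s * (3 / 5) := by
          rw [← Finset.sum_mul, hprior, one_mul]
      _ ≤ _ := by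
          gcongr with p _
          simp only [W, mul_assoc, ← Finset.mul_sum]
          gcongr
          refine hT.le_sum_integral hε ?_ (numNonzero_smul_sparseVector_le e p _) hw hw1 hwε
          rw [norm_smul, norm_sparseVector hs, mul_one]
          exact haγ.trans (le_abs_self _)
  have h6 := h2.trans h4
  simp only [W] at h1 h5
  norm_num at h6
  linarith

end RobustTesting

theorem mainTheorem1 (ε γ : ℝ) (hε : 0 < ε) (hγ : 0 < γ) :
    ∃ c : ℝ, 0 < c ∧ ∀ n d s : ℕ, 1 ≤ s → s ≤ d →
      (∃ T : Kernel (Fin n → EuclideanSpace ℝ (Fin d)) Bool,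
        IsMarkovKernel T ∧ RobustTesting.Distinguishes ε γ s T) →
      c * (s * Real.log (Real.exp 1 * d / s)) ≤ n := by
  -- The denominator ensures `δ ≤ ε / 10` and `δ ≤ 1` for every `ε > 0`.
  set δ := ε / (10 * (1 + ε)) with hδ
  have hδ0 : 0 < δ := by positivity
  have hδε : δ ≤ ε / 10 := by
    rw [hδ]
    gcongr
    linarith
  have hδ1 : δ ≤ 1 := by
    rw [hδ, div_le_one (by positivity)]
    linarith
  set A := γ / δ with hA
  set K := A ^ 4 * Real.exp (A ^ 2)
  have hK : 0 < K := by positivity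
  -- `160 = 2 * 80`, the 2 coming from `log_exp_one_mul_div_le`.
  refine ⟨1 / (160 * K), by positivity, fun n d s hs hsd ⟨T, _, hT⟩ => ?_⟩
  -- Centring forces the corrupted value `-(1 - δ) γ / δ = -(1 - δ) A`; both values are at most `A =
  -- γ / δ` in modulus.
  have h := hT.lt_mul_sample_size hε hs hsd (w := fun b => if b then δ else 1 - δ)
    (a := fun b => if b then -((1 - δ) * A) else γ) (A := A) ?_ ?_ ?_ ?_ ?_ ?_
  · have h1 := mul_le_mul_of_nonneg_left (RobustTesting.log_exp_one_mul_div_le hs hsd)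
      (Nat.cast_nonneg (α := ℝ) s)
    rw [one_div_mul_eq_div, div_le_iff₀ (by positivity)]
    linarith
  · intro b
    cases b <;> simp [hδ0.le, hδ1]
  · simp
  · have : δ * A = γ := by rw [hA]; field_simp
    simp
    linear_combination (δ - 1) * this
  · simpa using hδε
  · simp
  · have hA0 : 0 ≤ A := by positivity
    have hγA : γ ≤ A := le_div_self hγ.le hδ0 hδ1
    intro b
    cases b
    · simpa [abs_of_pos hγ] using hγA
    · simp only [if_true, abs_neg]
      rw [abs_of_nonneg (mul_nonneg (by linarith) hA0)]
      nlinarith
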